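/- All groups are discrete. For a group $\Gamma$ let $C^*_r(\Gamma)\subseteq B(\ell^2(\Gamma))$ be the norm-closed $*$-algebra generated by the left regular operators $\lambda_g$, $g\in\Gamma$. For a subgroup $N\le\Gamma$ let $P_N\colon C^*_r(\Gamma)\to C^*_r(N)$ be the canonical conditional expectation, given by $P_N(\lambda_g)=\lambda_g$ if $g\in N$ and $P_N(\lambda_g)=0$ otherwise. An ideal of $C^*_r(\Gamma)$ is said to be *induced from* $C^*_r(N)$ if it is of the form $$\mathrm{Ind}_N(I)=\{b\in C^*_r(\Gamma): P_N(xby)\in I\text{ for all }x,y\in C^*_r(\Gamma)\}$$ for some closed two-sided ideal $I$ of $C^*_r(N)$. (If $N$ is amenable, then $C^*(N)=C^*_r(N)$, and one says *induced from* $C^*(N)$.) An ideal is *primitive* if it is the kernel of an irreducible $*$-representation on a Hilbert space. A group $\Gamma$ is *C\*-simple* if $C^*_r(\Gamma)$ has no closed two-sided ideals other than $0$ and $C^*_r(\Gamma)$; its *amenable radical* $R(\Gamma)$ is its largest amenable normal subgroup. Let $H$ be an amenable nontrivial subgroup of a group $G$, and let $K:=\mathbb{Z}_2\wr_{G/H}G=\left(\bigoplus_{G/H}\mathbb{Z}_2\right)\rtimes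 G$, where $G$ acts by translation of the index set $G/H$. 1. If $H$ has infinite index in $G$, then $C^*_r(K)$ has a primitive ideal that is not induced from $C^*(\bigoplus_{G/H}\mathbb{Z}_2)$. 2. If $G$ is C\*-simple, then $R(K)=\bigoplus_{G/H}\mathbb{Z}_2$, the quotient $K/R(K)$ is C\*-simple, and $C^*_r(K)$ has a primitive ideal that is not induced from $C^*(R(K))$. -/

import Mathlib

open scoped ENNReal

noncomputable section

universe u

/-! ### The regular representation and the reduced group C*-algebra -/

/-- The Hilbert space `ℓ²(α)` of square-summable complex functions on a set `α`. -/
abbrev EllTwo (α : Type u) : Type u := lp (fun _ : α => ℂ) 2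

/-- The bounded operator `ℓ²(β) → ℓ²(α)`, `ξ ↦ ξ ∘ f`, given by an injective map `f : α → β`. -/
def pullback {α β : Type u} (f : α ↪ β) : EllTwo β →L[ℂ] EllTwo α :=
  LinearMap.mkContinuous
    { toFun := fun ξ => ⟨fun x => ξ (f x), by
        have h := (lp.memℓp ξ).summable (by norm_num)
        exact memℓp_gen (h.comp_injective f.injective)⟩
      map_add' := fun _ _ => rfl
      map_smul' := fun _ _ => rfl } 1 (by
    intro ξ
    rw [one_mul]
    refine lp.norm_le_of_forall_sum_le (by norm_num) (norm_nonneg _) fun s => ?_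
    have h := lp.sum_rpow_le_norm_rpow (p := 2) (by norm_num) ξ (s.map f)
    rw [Finset.sum_map] at h
    exact h)

@[simp]
theorem pullback_apply {α β : Type u} (f : α ↪ β) (ξ : EllTwo β) (x : α) :
    pullback f ξ x = ξ (f x) := rfl

theorem pullback_adjoint_apply {α β : Type u} (f : α ↪ β) (ξ : EllTwo α) (x : α) :
    (pullback f).adjoint ξ (f x) = ξ x := by
  classical
  have h := ContinuousLinearMap.adjoint_inner_right (pullback f) (lp.single 2 (f x) (1 : ℂ)) ξ
  rw [lp.inner_single_left] at h
  have h2 : pullback f (lp.single 2 (f x) (1 : ℂ)) = lp.single 2 x (1 : ℂ) := by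
    ext y
    simp [lp.single_apply, Pi.single_apply]
  rw [h2, lp.inner_single_left] at h
  simpa using h

theorem pullback_adjoint_apply_of_notMem {α β : Type u} (f : α ↪ β) (ξ : EllTwo α) (y : β)
    (hy : y ∉ Set.range f) : (pullback f).adjoint ξ y = 0 := by
  classical
  have h := ContinuousLinearMap.adjoint_inner_right (pullback f) (lp.single 2 y (1 : ℂ)) ξ
  rw [lp.inner_single_left] at h
  have h2 : pullback f (lp.single 2 y (1 : ℂ)) = 0 := by
    ext x
    have : f x ≠ y := fun e => hy ⟨x, e⟩
    simp [lp.single_apply, this]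
  rw [h2] at h
  simpa using h

variable {Γ : Type u} [Group Γ]

/-- The left regular representation of a discrete group: `(λ_g ξ)(x) = ξ(g⁻¹x)` on `ℓ²(Γ)`. -/
def leftRegular (g : Γ) : EllTwo Γ →L[ℂ] EllTwo Γ :=
  pullback ⟨fun x => g⁻¹ * x, mul_right_injective g⁻¹⟩

theorem leftRegular_apply (g : Γ) (ξ : EllTwo Γ) (x : Γ) :
    leftRegular g ξ x = ξ (g⁻¹ * x) := rfl

theorem leftRegular_one : leftRegular (1 : Γ) = 1 := by
  ext ξ x; simp [leftRegular_apply]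

theorem leftRegular_mul (g h : Γ) : leftRegular (g * h) = leftRegular g * leftRegular h := by
  ext ξ x
  simp [leftRegular_apply, ContinuousLinearMap.mul_def, mul_assoc]

theorem star_leftRegular (g : Γ) : star (leftRegular g) = leftRegular g⁻¹ := by
  ext ξ x
  rw [ContinuousLinearMap.star_eq_adjoint, leftRegular_apply, inv_inv]
  have h := pullback_adjoint_apply (⟨fun x => g⁻¹ * x, mul_right_injective g⁻¹⟩ : Γ ↪ Γ) ξ (g * x)
  simpa [leftRegular] using h

variable (Γ) in
/-- The reduced group C*-algebra `C*_r(Γ)`: the norm-closed unital *-subalgebra of the bounded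
operators on `ℓ²(Γ)` generated by the operators `λ_g`, `g ∈ Γ`. -/
def ReducedCStar : StarSubalgebra ℂ (EllTwo Γ →L[ℂ] EllTwo Γ) :=
  (StarAlgebra.adjoin ℂ (Set.range (leftRegular (Γ := Γ)))).topologicalClosure

theorem leftRegular_mem (g : Γ) : leftRegular g ∈ ReducedCStar Γ :=
  StarSubalgebra.le_topologicalClosure _ (StarAlgebra.subset_adjoin ℂ _ ⟨g, rfl⟩)

theorem isClosed_reducedCStar : IsClosed (ReducedCStar Γ : Set (EllTwo Γ →L[ℂ] EllTwo Γ)) :=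
  StarSubalgebra.isClosed_topologicalClosure _

theorem adjoin_leftRegular_subset_span :
    (StarAlgebra.adjoin ℂ (Set.range (leftRegular (Γ := Γ))) :
      Set (EllTwo Γ →L[ℂ] EllTwo Γ)) ⊆ Submodule.span ℂ (Set.range (leftRegular (Γ := Γ))) := by
  intro a ha
  induction ha using StarAlgebra.adjoin_induction with
  | mem x hx => exact Submodule.subset_span hx
  | algebraMap r =>
    rw [Algebra.algebraMap_eq_smul_one, ← leftRegular_one]
    exact Submodule.smul_mem _ _ (Submodule.subset_span ⟨1, rfl⟩)
  | add x y _ _ hx hy => exact Submodule.add_mem _ hx hy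
  | mul x y _ _ hx hy =>
    have h := Submodule.mul_mem_mul hx hy
    rw [Submodule.span_mul_span] at h
    refine Submodule.span_mono ?_ h
    rintro _ ⟨_, ⟨g, rfl⟩, _, ⟨h, rfl⟩, rfl⟩
    exact ⟨g * h, leftRegular_mul g h⟩
  | star x hx' hx =>
    clear hx'
    induction hx using Submodule.span_induction with
    | mem x hx =>
      obtain ⟨g, rfl⟩ := hx
      exact Submodule.subset_span ⟨g⁻¹, (star_leftRegular g).symm⟩
    | zero => simp
    | add x y _ _ hx hy => rw [star_add]; exact Submodule.add_mem _ hx hy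
    | smul c x _ hx => rw [star_smul]; exact Submodule.smul_mem _ _ hx

/-! ### The canonical conditional expectation onto the C*-algebra of a subgroup -/

/-- Compression `a ↦ R a R*` of operators on `ℓ²(Γ)` to operators on `ℓ²(N)`, where
`R : ℓ²(Γ) → ℓ²(N)` is restriction of functions (so that `R*` is extension by zero). -/
def compression (N : Subgroup Γ) :
    (EllTwo Γ →L[ℂ] EllTwo Γ) →ₗ[ℂ] (EllTwo N →L[ℂ] EllTwo N) where
  toFun a := pullback (Function.Embedding.subtype (· ∈ N)) ∘L a ∘L
    (pullback (Function.Embedding.subtype (· ∈ N))).adjoint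
  map_add' a b := by ext ξ x; simp
  map_smul' c a := by ext ξ x; simp

theorem continuous_compression (N : Subgroup Γ) : Continuous (compression N) := by
  change Continuous fun a : EllTwo Γ →L[ℂ] EllTwo Γ =>
    pullback (Function.Embedding.subtype (· ∈ N)) ∘L a ∘L
      (pullback (Function.Embedding.subtype (· ∈ N))).adjoint
  fun_prop

theorem compression_leftRegular_of_mem (N : Subgroup Γ) (n : N) :
    compression N (leftRegular (n : Γ)) = leftRegular n := by
  ext ξ x
  exact pullback_adjoint_apply (Function.Embedding.subtype (· ∈ N)) ξ (n⁻¹ * x)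

theorem compression_leftRegular_of_notMem (N : Subgroup Γ) (g : Γ) (hg : g ∉ N) :
    compression N (leftRegular g) = 0 := by
  ext ξ x
  refine pullback_adjoint_apply_of_notMem (Function.Embedding.subtype (· ∈ N)) ξ (g⁻¹ * x) ?_
  rintro ⟨y, hy⟩
  apply hg
  have h : g = x * (y : Γ)⁻¹ := by
    have hy' : (y : Γ) = g⁻¹ * x := hy
    rw [hy']; group
  rw [h]
  exact N.mul_mem x.2 (N.inv_mem y.2)

theorem compression_mem (N : Subgroup Γ) {a : EllTwo Γ →L[ℂ] EllTwo Γ}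
    (ha : a ∈ ReducedCStar Γ) : compression N a ∈ ReducedCStar N := by
  have hcl : IsClosed {b : EllTwo Γ →L[ℂ] EllTwo Γ | compression N b ∈ ReducedCStar N} :=
    isClosed_reducedCStar.preimage (continuous_compression N)
  refine closure_minimal ?_ hcl ha
  intro b hb
  have hb' := adjoin_leftRegular_subset_span hb
  change compression N b ∈ ReducedCStar N
  clear hb
  induction hb' using Submodule.span_induction with
  | mem x hx =>
    obtain ⟨g, rfl⟩ := hx
    by_cases hg : g ∈ N
    · rw [compression_leftRegular_of_mem N ⟨g, hg⟩]; exact leftRegular_mem _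
    · rw [compression_leftRegular_of_notMem N g hg]; exact zero_mem _
  | zero => rw [map_zero]; exact zero_mem _
  | add x y hx' hy' hx hy => rw [map_add]; exact add_mem hx hy
  | smul c x _ hx => rw [map_smul]; exact (ReducedCStar N).smul_mem hx c

/-- The canonical conditional expectation `P_N : C*_r(Γ) → C*_r(N)` for a subgroup `N ≤ Γ`; it is
the compression to `ℓ²(N)`, that is, the bounded linear map with `P_N(λ_g) = λ_g` for `g ∈ N` and
`P_N(λ_g) = 0` for `g ∉ N`. -/
def condExpSubgroup (N : Subgroup Γ) : ReducedCStar Γ →ₗ[ℂ] ReducedCStar N where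
  toFun a := ⟨compression N a, compression_mem N a.2⟩
  map_add' a b := Subtype.ext
    ((compression N).map_add (a : EllTwo Γ →L[ℂ] EllTwo Γ) (b : EllTwo Γ →L[ℂ] EllTwo Γ))
  map_smul' c a := Subtype.ext ((compression N).map_smul c (a : EllTwo Γ →L[ℂ] EllTwo Γ))

/-! ### Induced ideals, primitive ideals, simplicity -/

/-- The ideal `{b ∈ C*_r(Γ) : P_N(x b y) ∈ I for all x, y ∈ C*_r(Γ)}` induced, via `P_N`, from an
ideal `I` of `C*_r(N)`. -/
def inducedIdeal (N : Subgroup Γ) (I : TwoSidedIdeal (ReducedCStar N)) :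
    TwoSidedIdeal (ReducedCStar Γ) :=
  TwoSidedIdeal.mk' {b | ∀ x y : ReducedCStar Γ, condExpSubgroup N (x * b * y) ∈ I}
    (fun x y => by simp [I.zero_mem])
    (fun {a b} ha hb x y => by
      rw [mul_add, add_mul, map_add]; exact I.add_mem (ha x y) (hb x y))
    (fun {a} ha x y => by
      rw [mul_neg, neg_mul, map_neg]; exact I.neg_mem (ha x y))
    (fun {a b} hb x y => by
      rw [← mul_assoc]; exact hb (x * a) y)
    (fun {a b} ha x y => by
      rw [← mul_assoc, mul_assoc (x * a)]; exact ha x (b * y))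

theorem mem_inducedIdeal (N : Subgroup Γ) (I : TwoSidedIdeal (ReducedCStar N))
    (b : ReducedCStar Γ) :
    b ∈ inducedIdeal N I ↔ ∀ x y : ReducedCStar Γ, condExpSubgroup N (x * b * y) ∈ I :=
  TwoSidedIdeal.mem_mk' ..

/-- `J` is induced from `C*_r(N)`: it is the ideal induced from some (closed two-sided) ideal of
`C*_r(N)`. -/
def IsInducedFrom (N : Subgroup Γ) (J : TwoSidedIdeal (ReducedCStar Γ)) : Prop :=
  ∃ I : TwoSidedIdeal (ReducedCStar N), IsClosed (I : Set (ReducedCStar N)) ∧ J = inducedIdeal N I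

/-- A *-representation on a Hilbert space is irreducible if the space is nonzero and has no closed
invariant subspaces other than the two trivial ones. -/
def IsIrreducibleRep {A E : Type u} [Ring A] [StarRing A] [Algebra ℂ A]
    [NormedAddCommGroup E] [InnerProductSpace ℂ E] [CompleteSpace E]
    (π : A →⋆ₐ[ℂ] (E →L[ℂ] E)) : Prop :=
  Nontrivial E ∧ ∀ W : Submodule ℂ E, IsClosed (W : Set E) →
    (∀ a : A, ∀ ξ ∈ W, π a ξ ∈ W) → W = ⊥ ∨ W = ⊤

/-- A primitive ideal of `C*_r(Γ)`: the kernel of an irreducible *-representation on a Hilbert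
space. -/
def IsPrimitiveIdeal (J : TwoSidedIdeal (ReducedCStar Γ)) : Prop :=
  ∃ (E : Type u) (_ : NormedAddCommGroup E) (_ : InnerProductSpace ℂ E) (_ : CompleteSpace E)
    (π : ReducedCStar Γ →⋆ₐ[ℂ] (E →L[ℂ] E)),
    IsIrreducibleRep π ∧ ∀ a : ReducedCStar Γ, a ∈ J ↔ π a = 0

variable (Γ) in
/-- `Γ` is C*-simple: `C*_r(Γ)` has no closed two-sided ideals other than `0` and itself. -/
def IsCStarSimple : Prop :=
  ∀ I : TwoSidedIdeal (ReducedCStar Γ), IsClosed (I : Set (ReducedCStar Γ)) → I = ⊥ ∨ I = ⊤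

/-! ### Amenability -/

variable (Γ) in
/-- A discrete group is amenable if there is a left-invariant mean on `ℓ^∞(Γ)`. -/
def IsAmenableGroup : Prop :=
  ∃ m : lp (fun _ : Γ => ℝ) ∞ →ₗ[ℝ] ℝ,
    m 1 = 1 ∧
    (∀ f, (∀ x, 0 ≤ f x) → 0 ≤ m f) ∧
    ∀ (g : Γ) (f f' : lp (fun _ : Γ => ℝ) ∞), (∀ x, f' x = f (g⁻¹ * x)) → m f' = m f

/-- `R` is the amenable radical of `Γ`: its largest amenable normal subgroup. -/
def IsAmenableRadical (R : Subgroup Γ) : Prop :=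
  IsGreatest {N : Subgroup Γ | N.Normal ∧ IsAmenableGroup N} R

/-! ### The wreath product `ℤ₂ ≀_{G/H} G` -/

variable {G : Type u} [Group G]

/-- The action of `G` on `⊕_{G/H} ℤ₂` (written multiplicatively) by translation of the index set:
`(g · f)(kH) = f(g⁻¹kH)`. -/
def shiftAction (H : Subgroup G) : G →* MulAut (Multiplicative (G ⧸ H →₀ ZMod 2)) where
  toFun g := AddEquiv.toMultiplicative (Finsupp.domCongr (MulAction.toPerm g))
  map_one' := by
    ext f x
    simp [Finsupp.domCongr]
  map_mul' g h := by
    ext f x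
    simp [Finsupp.domCongr, mul_smul]

theorem shiftAction_apply (H : Subgroup G) (g : G) (f : Multiplicative (G ⧸ H →₀ ZMod 2))
    (x : G ⧸ H) : (shiftAction H g f).toAdd x = f.toAdd (g⁻¹ • x) := rfl

/-- The wreath product `ℤ₂ ≀_{G/H} G = (⊕_{G/H} ℤ₂) ⋊ G`. -/
abbrev WreathZTwo (H : Subgroup G) : Type u :=
  Multiplicative (G ⧸ H →₀ ZMod 2) ⋊[shiftAction H] G

/-- The subgroup `⊕_{G/H} ℤ₂` of `ℤ₂ ≀_{G/H} G`. -/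
abbrev wreathBase (H : Subgroup G) : Subgroup (WreathZTwo H) :=
  (SemidirectProduct.inl : Multiplicative (G ⧸ H →₀ ZMod 2) →* WreathZTwo H).range

instance wreathBase_normal (H : Subgroup G) : (wreathBase H).Normal := by
  rw [wreathBase, SemidirectProduct.range_inl_eq_ker_rightHom]
  infer_instance

end

/-! Write `K` for the wreath product, `N` for its base `⊕_{G/H} ℤ₂` and `L = N ⋊ H`. The group `L`
is amenable and carries the character `χ(f, h) = (-1)^{f(H)}`. Amenability makes `χ` a state on
`C*_r(L)`, and composing it with the expectation onto `C*_r(L)` gives a state on `C*_r(K)`. In its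
GNS representation `π` the cyclic vector `v` satisfies `π(λ_l) v = χ(l) v` for `l ∈ L`.

Let `d ∈ N` be the point mass at the coset `H` and put `p = 1 - λ_d`. For `k ∉ L` the conjugate
`k⁻¹dk` is the point mass at another coset, where `χ` is `1`, so `π(p λ_k) v = 0`. For `k ∈ L` this
vector is a multiple of `v`. Hence `π(p)` has range `ℂv`, which together with cyclicity forces `π`
to be irreducible (`isIrreducibleRep_of_rank_one`).

Take `h ≠ 1` in `H`. It commutes with `d` and fixes `v`, so `p(λ_h - 1)` lies in `J = ker π`. Since
`h ∉ N`, an ideal induced from `N` cannot see the two terms of this product separately, so it would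
also contain `p` (`one_sub_mem_of_isInducedFrom`). But `π(p) v = 2v ≠ 0`. The argument is
axiomatised in `exists_primitiveIdeal_not_induced`.

For the radical, the same GNS construction with the trivial character shows that a C*-simple group
has no nontrivial amenable normal subgroup. This is applied to images in `G ≅ K/N`. -/

noncomputable section

universe v

/-! ### Pointwise operations on real sequence spaces -/

section lpReal

variable {α : Type*} {p : ℝ≥0∞} (f g : lp (fun _ : α => ℝ) p) (x : α)

theorem lpReal_add_apply : (f + g) x = f x + g x := rfl

theorem lpReal_sub_apply : (f - g) x = f x - g x := rfl

theorem lpReal_smul_apply (c : ℝ) : (c • f) x = c * f x := rfl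

theorem lpReal_sum_apply {ι : Type*} (s : Finset ι) (F : ι → lp (fun _ : α => ℝ) p) :
    (∑ i ∈ s, F i) x = ∑ i ∈ s, F i x := by
  classical
  induction s using Finset.induction_on with
  | empty => rfl
  | insert i s hi ih => rw [Finset.sum_insert hi, Finset.sum_insert hi, lpReal_add_apply, ih]

end lpReal

/-! ### Means on bounded functions -/

/-- Precomposition of bounded functions with a map, as a linear map. -/
def boundedComp {α β : Type v} (r : α → β) :
    lp (fun _ : β => ℝ) ∞ →ₗ[ℝ] lp (fun _ : α => ℝ) ∞ where
  toFun f := ⟨fun x => f (r x), memℓp_infty (by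
    obtain ⟨C, hC⟩ := (lp.memℓp f).bddAbove
    exact ⟨C, by rintro _ ⟨x, rfl⟩; exact hC ⟨r x, rfl⟩⟩)⟩
  map_add' _ _ := rfl
  map_smul' _ _ := rfl

@[simp]
theorem boundedComp_apply {α β : Type v} (r : α → β) (f : lp (fun _ : β => ℝ) ∞) (x : α) :
    boundedComp r f x = f (r x) := rfl

/-- A bounded real function as an element of `ℓ^∞`. -/
def boundedFunction {α : Type v} (f : α → ℝ) (C : ℝ) (h : ∀ x, |f x| ≤ C) :
    lp (fun _ : α => ℝ) ∞ :=
  ⟨f, memℓp_infty ⟨C, by rintro _ ⟨x, rfl⟩; exact h x⟩⟩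

@[simp]
theorem boundedFunction_apply {α : Type v} (f : α → ℝ) (C : ℝ) (h : ∀ x, |f x| ≤ C) (x : α) :
    boundedFunction f C h x = f x := rfl

theorem mean_mono {α : Type v} {m : lp (fun _ : α => ℝ) ∞ →ₗ[ℝ] ℝ}
    (hpos : ∀ f, (∀ x, 0 ≤ f x) → 0 ≤ m f) {f g : lp (fun _ : α => ℝ) ∞} (h : ∀ x, f x ≤ g x) :
    m f ≤ m g := by
  have := hpos (g - f) (fun x => by simpa using h x)
  rw [map_sub] at this
  linarith

theorem le_mean {α : Type v} {m : lp (fun _ : α => ℝ) ∞ →ₗ[ℝ] ℝ} (h1 : m 1 = 1)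
    (hpos : ∀ f, (∀ x, 0 ≤ f x) → 0 ≤ m f) {f : lp (fun _ : α => ℝ) ∞} {c : ℝ}
    (h : ∀ x, c ≤ f x) : c ≤ m f := by
  have := mean_mono hpos (f := c • 1) (g := f) (fun x => by simpa [lp.infty_coeFn_one] using h x)
  simpa [h1] using this

theorem mean_le {α : Type v} {m : lp (fun _ : α => ℝ) ∞ →ₗ[ℝ] ℝ} (h1 : m 1 = 1)
    (hpos : ∀ f, (∀ x, 0 ≤ f x) → 0 ≤ m f) {f : lp (fun _ : α => ℝ) ∞} {c : ℝ}
    (h : ∀ x, f x ≤ c) : m f ≤ c := by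
  have := mean_mono hpos (f := f) (g := c • 1) (fun x => by simpa [lp.infty_coeFn_one] using h x)
  simpa [h1] using this

theorem abs_mean_le {α : Type v} {m : lp (fun _ : α => ℝ) ∞ →ₗ[ℝ] ℝ} (h1 : m 1 = 1)
    (hpos : ∀ f, (∀ x, 0 ≤ f x) → 0 ≤ m f) (f : lp (fun _ : α => ℝ) ∞) : |m f| ≤ ‖f‖ := by
  have h : ∀ x, |f x| ≤ ‖f‖ := fun x => lp.norm_apply_le_norm (by simp) f x
  exact abs_le.2 ⟨le_mean h1 hpos fun x => (abs_le.1 (h x)).1,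
    mean_le h1 hpos fun x => (abs_le.1 (h x)).2⟩

theorem boundedComp_one {α β : Type v} (r : α → β) : boundedComp r 1 = 1 := by
  ext x; simp [lp.infty_coeFn_one]

/-! ### Permanence properties of amenability -/

theorem IsAmenableGroup.of_surjective {Γ Q : Type v} [Group Γ] [Group Q] (h : IsAmenableGroup Γ)
    (ρ : Γ →* Q) (hρ : Function.Surjective ρ) : IsAmenableGroup Q := by
  obtain ⟨m, h1, hpos, hinv⟩ := h
  refine ⟨m ∘ₗ boundedComp ρ, ?_, fun f hf => hpos _ fun x => hf _, fun g f f' hff' => ?_⟩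
  · simp [boundedComp_one, h1]
  · obtain ⟨γ, rfl⟩ := hρ g
    exact hinv γ _ _ fun x => by simp [hff']

/-- Average over each coset with the mean of `N`, then over `Q`. Only `ker ρ ⊆ range i` is needed,
and `hcoset` makes the coset average independent of the chosen section. -/
theorem IsAmenableGroup.of_extension {N Γ Q : Type v} [Group N] [Group Γ] [Group Q]
    (hN : IsAmenableGroup N) (hQ : IsAmenableGroup Q) (i : N →* Γ) (ρ : Γ →* Q)
    (hρ : Function.Surjective ρ) (hi : ∀ g, ρ g = 1 → ∃ n, i n = g) : IsAmenableGroup Γ := by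
  obtain ⟨m, h1, hpos, hinv⟩ := hN
  obtain ⟨m', h1', hpos', hinv'⟩ := hQ
  obtain ⟨σ, hσ⟩ := hρ.hasRightInverse
  have hcoset : ∀ (g g' : Γ) (f : lp (fun _ : Γ => ℝ) ∞), ρ g = ρ g' →
      m (boundedComp (fun n => g * i n) f) = m (boundedComp (fun n => g' * i n) f) := by
    intro g g' f hg
    obtain ⟨n, hn⟩ := hi (g'⁻¹ * g) (by simp [hg])
    refine hinv n⁻¹ _ _ fun x => ?_
    have : g' * (i n * i x) = g * i x := by rw [hn]; group
    simp [this]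
  have hle : ∀ (r : N → Γ) (f : lp (fun _ : Γ => ℝ) ∞), |m (boundedComp r f)| ≤ ‖f‖ := by
    intro r f
    refine (abs_mean_le h1 hpos _).trans (lp.norm_le_of_forall_le (norm_nonneg _) fun x => ?_)
    exact lp.norm_apply_le_norm (by simp) f (r x)
  let T : lp (fun _ : Γ => ℝ) ∞ →ₗ[ℝ] lp (fun _ : Q => ℝ) ∞ :=
    { toFun := fun f => boundedFunction (fun q => m (boundedComp (fun n => σ q * i n) f)) ‖f‖
        fun q => hle _ f
      map_add' := fun f g => by ext q; simp
      map_smul' := fun c f => by ext q; simp }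
  have hT : ∀ f q, T f q = m (boundedComp (fun n => σ q * i n) f) := fun f q => rfl
  refine ⟨m' ∘ₗ T, ?_, fun f hf => hpos' _ fun q => ?_, fun g f f' hff' => ?_⟩
  · have : T 1 = 1 := by
      ext q; simp [hT, boundedComp_one, h1, lp.infty_coeFn_one]
    simp [this, h1']
  · rw [hT]
    exact hpos _ fun x => hf _
  · refine hinv' (ρ g) _ _ fun q => ?_
    -- `σ ((ρ g)⁻¹ * q)` and `g⁻¹ * σ q` lie over the same point of `Q`, so either may represent the
    -- coset.
    rw [hT, hT, ← hcoset (g⁻¹ * σ q) _ f (by simp [hσ (_)])]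
    congr 1
    ext n
    simp [hff', mul_assoc]

theorem exists_tendsto_ultrafilter {ι E : Type*} [NormedAddCommGroup E] [ProperSpace E]
    (U : Ultrafilter ι) (f : ι → E) (C : ℝ) (h : ∀ i, ‖f i‖ ≤ C) :
    ∃ z, Filter.Tendsto f U (nhds z) := by
  obtain ⟨z, -, hz⟩ := (isCompact_closedBall (0 : E) C).ultrafilter_le_nhds (U.map f) (by
    rw [Filter.le_principal_iff]
    exact Filter.mem_map.2 (Filter.Eventually.of_forall fun i => by simpa using h i))
  exact ⟨z, hz⟩

/-- The group is the directed union of the finite subgroups `B Y` of elements supported in `Y`. An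
ultrafilter limit of the averages over `B Y` is invariant, since any given `g` eventually lies in `B
Y`. -/
theorem isAmenableGroup_finsupp_zmod_two (X : Type v) :
    IsAmenableGroup (Multiplicative (X →₀ ZMod 2)) := by
  classical
  let B : Finset X → Finset (Multiplicative (X →₀ ZMod 2)) := fun Y =>
    (Y.finsupp fun _ => (Finset.univ : Finset (ZMod 2))).map Multiplicative.ofAdd.toEmbedding
  have hB : ∀ Y a, a ∈ B Y ↔ a.toAdd.support ⊆ Y := by
    intro Y a
    simp only [B, Finset.mem_map_equiv, Finset.mem_finsupp_iff]
    simp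
  have hone : ∀ Y, 1 ∈ B Y := fun Y => (hB Y 1).2 (by simp)
  have hcard : ∀ Y, (0 : ℝ) < (B Y).card := fun Y => by
    exact_mod_cast Finset.card_pos.2 ⟨1, hone Y⟩
  let av : Finset X → lp (fun _ : Multiplicative (X →₀ ZMod 2) => ℝ) ∞ → ℝ := fun Y f =>
    (∑ a ∈ B Y, f a) / (B Y).card
  have hav : ∀ f Y, ‖av Y f‖ ≤ ‖f‖ := by
    intro f Y
    simp only [av, norm_div, Real.norm_natCast]
    rw [div_le_iff₀ (hcard Y)]
    refine (norm_sum_le _ _).trans ?_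
    refine (Finset.sum_le_card_nsmul _ _ ‖f‖ fun x _ =>
      lp.norm_apply_le_norm (by simp) f x).trans ?_
    rw [nsmul_eq_mul, mul_comm]
  let U : Ultrafilter (Finset X) := Ultrafilter.of Filter.atTop
  have hU : (U : Filter (Finset X)) ≤ Filter.atTop := Ultrafilter.of_le _
  choose m hm using fun f => exists_tendsto_ultrafilter U (fun Y => av Y f) ‖f‖ (hav f)
  refine ⟨{ toFun := m, map_add' := ?_, map_smul' := ?_ }, ?_, ?_, ?_⟩
  · intro f g
    refine tendsto_nhds_unique (hm (f + g)) (((hm f).add (hm g)).congr fun Y => ?_)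
    simp only [av, lpReal_add_apply, Finset.sum_add_distrib, add_div]
  · intro c f
    refine tendsto_nhds_unique (hm (c • f)) (((hm f).const_mul c).congr fun Y => ?_)
    simp only [av, lpReal_smul_apply, ← Finset.mul_sum, mul_div_assoc]
  · refine tendsto_nhds_unique (hm 1) (tendsto_const_nhds.congr fun Y => ?_)
    simp [av, lp.infty_coeFn_one, (hcard Y).ne']
  · intro f hf
    exact ge_of_tendsto' (hm f) fun Y =>
      div_nonneg (Finset.sum_nonneg fun a _ => hf a) (hcard Y).le
  · intro g f f' hff'
    refine tendsto_nhds_unique (hm f') ((hm f).congr' ?_)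
    have hev : ∀ᶠ Y in Filter.atTop, g.toAdd.support ⊆ Y := Filter.eventually_ge_atTop _
    filter_upwards [hU hev] with Y hY
    simp only [av]
    congr 1
    refine Finset.sum_bij' (fun a _ => g * a) (fun a _ => g⁻¹ * a) ?_ ?_ ?_ ?_ ?_
    · intro a ha
      rw [hB] at ha ⊢
      exact Finsupp.support_add.trans (Finset.union_subset hY ha)
    · intro a ha
      rw [hB] at ha ⊢
      refine Finsupp.support_add.trans (Finset.union_subset ?_ ha)
      simpa using hY
    · simp
    · simp
    · intro a _
      simp [hff']

/-! ### Almost invariant vectors -/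

/-- Day's convexity argument. If the tuples `b x = (δ_{sx} - δ_x)_s` did not have `0` in their
closed convex hull, a functional `u` would satisfy `u (b x) ≥ c > 0` for all `x`. But `x ↦ u (b x)`
is a sum of differences of translates of bounded functions, so its invariant mean is `0`. -/
theorem IsAmenableGroup.exists_almost_invariant_density {Γ : Type v} [Group Γ]
    (hΓ : IsAmenableGroup Γ) (S : Finset Γ) {ε : ℝ} (hε : 0 < ε) :
    ∃ f : Γ → ℝ, (∀ x, 0 ≤ f x) ∧ HasSum f 1 ∧
      ∀ s ∈ S, ∃ c ≤ ε, HasSum (fun x => |f (s⁻¹ * x) - f x|) c := by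
  classical
  obtain ⟨m, h1, hpos, hinv⟩ := hΓ
  let δ : Γ → lp (fun _ : Γ => ℝ) 1 := fun x => lp.single 1 x (1 : ℝ)
  let b : Γ → S → lp (fun _ : Γ => ℝ) 1 := fun x s => δ (s * x) - δ x
  let C : Set (S → lp (fun _ : Γ => ℝ) 1) := convexHull ℝ (Set.range b)
  have hδ : ∀ x, ‖δ x‖ = 1 := fun x => by simp [δ]
  have hC : (0 : S → lp (fun _ : Γ => ℝ) 1) ∈ closure C := by
    by_contra h0
    obtain ⟨u, c, huc, hu⟩ := geometric_hahn_banach_point_closed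
      (convex_convexHull ℝ (Set.range b)).closure isClosed_closure h0
    rw [map_zero] at huc
    let ψ : S → lp (fun _ : Γ => ℝ) ∞ := fun s =>
      boundedFunction (fun x => u (Pi.single s (δ x))) ‖u‖ fun x => by
        refine (u.le_opNorm _).trans ?_
        rw [Pi.norm_single, hδ, mul_one]
    let F : lp (fun _ : Γ => ℝ) ∞ :=
      ∑ s : S, (boundedComp (fun x => (s : Γ) * x) (ψ s) - ψ s)
    have hF : ∀ x, F x = u (b x) := by
      intro x
      have : b x = ∑ s : S, (Pi.single s (δ (s * x)) - Pi.single s (δ x)) := by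
        funext s
        simp only [b, Finset.sum_apply, Finset.sum_sub_distrib, Pi.sub_apply, Finset.sum_pi_single,
          Finset.mem_univ, if_true]
      rw [this, map_sum]
      simp only [F, lpReal_sum_apply, lpReal_sub_apply, map_sub]
      rfl
    have hmF : m F = 0 := by
      simp only [F, map_sum, map_sub]
      refine Finset.sum_eq_zero fun s _ => sub_eq_zero.2 ?_
      exact hinv (s : Γ)⁻¹ _ _ fun x => by simp
    have : c ≤ m F := le_mean h1 hpos fun x => by
      rw [hF]
      exact (hu _ (subset_closure (subset_convexHull ℝ _ ⟨x, rfl⟩))).le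
    linarith
  -- A point of the hull of the `b x` must be recognised as the translation differences of one
  -- density. `D` records this relation; it is convex and contains every `(δ x, b x)`.
  let D : Set (lp (fun _ : Γ => ℝ) 1 × (S → lp (fun _ : Γ => ℝ) 1)) :=
    {q | (∀ x, 0 ≤ q.1 x) ∧ HasSum q.1 1 ∧ ∀ s x, q.2 s x = q.1 ((s : Γ)⁻¹ * x) - q.1 x}
  have hDconv : Convex ℝ D := by
    intro q hq r hr a c ha hc hac
    refine ⟨fun x => ?_, ?_, fun s x => ?_⟩
    · have := hq.1 x
      have := hr.1 x
      change 0 ≤ a * q.1 x + c * r.1 x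
      positivity
    · have := (hq.2.1.mul_left a).add (hr.2.1.mul_left c)
      rw [mul_one, mul_one, hac] at this
      exact this
    · change a * q.2 s x + c * r.2 s x =
        (a * q.1 ((s : Γ)⁻¹ * x) + c * r.1 ((s : Γ)⁻¹ * x)) - (a * q.1 x + c * r.1 x)
      rw [hq.2.2 s x, hr.2.2 s x]
      ring
  have hsub : convexHull ℝ (Set.range fun x => (δ x, b x)) ⊆ D := by
    refine convexHull_min ?_ hDconv
    rintro _ ⟨x, rfl⟩
    refine ⟨fun y => ?_, ?_, fun s y => ?_⟩
    · simp only [δ, lp.single_apply, Pi.single_apply]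
      split_ifs <;> norm_num
    · have := hasSum_pi_single x (1 : ℝ)
      exact this
    · simp [b, δ, lp.single_apply, Pi.single_apply, inv_mul_eq_iff_eq_mul]
  obtain ⟨β, hβ, hβε⟩ := Metric.mem_closure_iff.1 hC ε hε
  have himg : C = (LinearMap.snd ℝ (lp (fun _ : Γ => ℝ) 1) (S → lp (fun _ : Γ => ℝ) 1)) ''
      convexHull ℝ (Set.range fun x => (δ x, b x)) := by
    rw [LinearMap.image_convexHull, ← Set.range_comp]
    rfl
  rw [himg] at hβ
  obtain ⟨q, hq, rfl⟩ := hβ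
  obtain ⟨hq0, hq1, hq2⟩ := hsub hq
  refine ⟨q.1, hq0, hq1, fun s hs => ⟨‖q.2 ⟨s, hs⟩‖, ?_, ?_⟩⟩
  · rw [dist_zero_left] at hβε
    exact (norm_le_pi_norm q.2 ⟨s, hs⟩).trans hβε.le
  · have := lp.hasSum_norm (p := 1) (by simp) (q.2 ⟨s, hs⟩)
    simpa [hq2] using this

open Filter Topology
open scoped ComplexOrder InnerProductSpace

/-! ### Vector states approximating a character of an amenable group -/

theorem EllTwo.hasSum_norm_sq {α : Type v} (ξ : EllTwo α) :
    HasSum (fun x => ‖ξ x‖ ^ 2) (‖ξ‖ ^ 2) := by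
  have h := lp.hasSum_norm (p := 2) (by norm_num) ξ
  simpa using h

/-- Turns `ℓ¹`-closeness of densities into `ℓ²`-closeness of their square roots. -/
theorem sq_sqrt_sub_sqrt_le {a b : ℝ} (ha : 0 ≤ a) (hb : 0 ≤ b) :
    (√a - √b) ^ 2 ≤ |a - b| := by
  have h : a - b = (√a - √b) * (√a + √b) := by
    have := Real.sq_sqrt ha
    have := Real.sq_sqrt hb
    nlinarith
  rw [h, abs_mul, ← sq_abs, sq]
  refine mul_le_mul_of_nonneg_left ?_ (abs_nonneg _)
  have := Real.sqrt_nonneg a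
  have := Real.sqrt_nonneg b
  rw [abs_of_nonneg (by positivity : 0 ≤ √a + √b)]
  exact abs_sub_le_iff.2 ⟨by linarith, by linarith⟩

variable {Γ : Type v} [Group Γ]

/-- Twist the square root of an almost invariant density by `χ`: `η(x) = χ(x⁻¹) √f(x)`. The `ℓ¹`
tolerance is `ε²` because it bounds a squared `ℓ²` norm. -/
theorem IsAmenableGroup.exists_almost_eigenvector (hΓ : IsAmenableGroup Γ) (χ : Γ →* ℂ)
    (hχ : ∀ g, ‖χ g‖ = 1) (S : Finset Γ) {ε : ℝ} (hε : 0 < ε) :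
    ∃ η : EllTwo Γ, ‖η‖ = 1 ∧ ∀ s ∈ S, ‖leftRegular s η - χ s • η‖ ≤ ε := by
  obtain ⟨f, hf0, hf1, hfS⟩ := hΓ.exists_almost_invariant_density S (pow_pos hε 2)
  have hnorm : ∀ x, ‖χ x⁻¹ * (√(f x) : ℂ)‖ ^ 2 = f x := by
    intro x
    rw [norm_mul, hχ, one_mul, Complex.norm_real, Real.norm_eq_abs, sq_abs, Real.sq_sqrt (hf0 x)]
  let η : EllTwo Γ := ⟨fun x => χ x⁻¹ * (√(f x) : ℂ), memℓp_gen (by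
    simpa only [ENNReal.toReal_ofNat, Real.rpow_ofNat, hnorm] using hf1.summable)⟩
  have hη : ∀ x, η x = χ x⁻¹ * (√(f x) : ℂ) := fun x => rfl
  refine ⟨η, ?_, fun s hs => ?_⟩
  · have h : ‖η‖ ^ 2 = 1 := (EllTwo.hasSum_norm_sq η).unique (by simpa only [hη, hnorm] using hf1)
    exact (pow_eq_one_iff_of_nonneg (norm_nonneg _) two_ne_zero).1 h
  · obtain ⟨c, hc, hsum⟩ := hfS s hs
    have hle := hasSum_le (fun x => ?_)
      (EllTwo.hasSum_norm_sq (leftRegular s η - χ s • η)) hsum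
    · exact (sq_le_sq₀ (norm_nonneg _) hε.le).1 (hle.trans hc)
    · have h : (leftRegular s η - χ s • η) x =
          χ s * χ x⁻¹ * ((√(f (s⁻¹ * x)) - √(f x) : ℝ) : ℂ) := by
        change leftRegular s η x - χ s * η x = _
        rw [leftRegular_apply, hη, hη, mul_inv_rev, inv_inv, map_mul]
        push_cast
        ring
      rw [h, norm_mul, norm_mul, hχ, hχ, one_mul, one_mul, Complex.norm_real, Real.norm_eq_abs,
        sq_abs]
      exact sq_sqrt_sub_sqrt_le (hf0 _) (hf0 _)

/-- An ultrafilter limit of the vector states of almost eigenvectors, indexed by a finite set and a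
precision `1 / (n + 1)`. -/
theorem IsAmenableGroup.exists_state (hΓ : IsAmenableGroup Γ) (χ : Γ →* ℂ)
    (hχ : ∀ g, ‖χ g‖ = 1) :
    ∃ Φ : (EllTwo Γ →L[ℂ] EllTwo Γ) →ₗ[ℂ] ℂ, (∀ T, T.IsPositive → 0 ≤ Φ T) ∧
      ∀ g, Φ (leftRegular g) = χ g := by
  classical
  have hex : ∀ i : Finset Γ × ℕ, ∃ η : EllTwo Γ, ‖η‖ = 1 ∧
      ∀ s ∈ i.1, ‖leftRegular s η - χ s • η‖ ≤ 1 / ((i.2 : ℝ) + 1) := fun i =>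
    hΓ.exists_almost_eigenvector χ hχ i.1 Nat.one_div_pos_of_nat
  choose η hη1 hηS using hex
  let U : Ultrafilter (Finset Γ × ℕ) := Ultrafilter.of atTop
  have hU : (U : Filter (Finset Γ × ℕ)) ≤ atTop := Ultrafilter.of_le _
  have hbd : ∀ (T : EllTwo Γ →L[ℂ] EllTwo Γ) i, ‖⟪η i, T (η i)⟫_ℂ‖ ≤ ‖T‖ := by
    intro T i
    refine (norm_inner_le_norm _ _).trans ?_
    have := T.le_opNorm (η i)
    rw [hη1, mul_one] at this
    rwa [hη1, one_mul]
  choose Φ hΦ using fun T : EllTwo Γ →L[ℂ] EllTwo Γ =>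
    exists_tendsto_ultrafilter U (fun i => ⟪η i, T (η i)⟫_ℂ) ‖T‖ (hbd T)
  refine ⟨{ toFun := Φ, map_add' := ?_, map_smul' := ?_ }, ?_, ?_⟩
  · intro S T
    refine tendsto_nhds_unique (hΦ (S + T)) (((hΦ S).add (hΦ T)).congr fun i => ?_)
    rw [add_apply, inner_add_right]
  · intro c T
    refine tendsto_nhds_unique (hΦ (c • T)) (((hΦ T).const_mul c).congr fun i => ?_)
    rw [smul_apply, inner_smul_right]
  · intro T hT
    exact ge_of_tendsto' (hΦ T) fun i => hT.inner_nonneg_right _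
  · intro g
    refine tendsto_nhds_unique (hΦ (leftRegular g)) ?_
    rw [tendsto_iff_norm_sub_tendsto_zero]
    have hlim : Tendsto (fun i : Finset Γ × ℕ => 1 / ((i.2 : ℝ) + 1)) U (𝓝 0) := by
      refine tendsto_one_div_add_atTop_nhds_zero_nat.comp (Tendsto.mono_left ?_ hU)
      rw [← prod_atTop_atTop_eq]
      exact tendsto_snd
    have hev : ∀ᶠ i : Finset Γ × ℕ in atTop, g ∈ i.1 := by
      filter_upwards [eventually_ge_atTop (({g}, 0) : Finset Γ × ℕ)] with i hi
      exact hi.1 (Finset.mem_singleton_self g)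
    refine squeeze_zero' (Eventually.of_forall fun i => norm_nonneg _) ?_ hlim
    filter_upwards [hU hev] with i hi
    have h : ⟪η i, leftRegular g (η i)⟫_ℂ - χ g = ⟪η i, leftRegular g (η i) - χ g • η i⟫_ℂ := by
      rw [inner_sub_right, inner_smul_right, inner_self_eq_norm_sq_to_K, hη1]
      simp
    rw [h]
    refine (norm_inner_le_norm _ _).trans ?_
    rw [hη1, one_mul]
    exact hηS i g hi

/-! ### The reduced group C*-algebra -/

variable (Γ) in
/-- The canonical homomorphism `g ↦ λ_g` of `Γ` into `C*_r(Γ)`. -/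
def regularUnitary : Γ →* ReducedCStar Γ where
  toFun g := ⟨leftRegular g, leftRegular_mem g⟩
  map_one' := Subtype.ext leftRegular_one
  map_mul' g h := Subtype.ext (leftRegular_mul g h)

theorem star_regularUnitary (g : Γ) : star (regularUnitary Γ g) = regularUnitary Γ g⁻¹ :=
  Subtype.ext (star_leftRegular g)

theorem regularUnitary_injective : Function.Injective (regularUnitary Γ) := by
  classical
  intro g h hgh
  have h1 : leftRegular g = leftRegular h := congrArg Subtype.val hgh
  have h2 := congrArg (fun T => (T (lp.single 2 (1 : Γ) (1 : ℂ))) g) h1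
  simp only [leftRegular_apply, lp.single_apply, inv_mul_cancel, Pi.single_eq_same] at h2
  by_contra hne
  rw [Pi.single_eq_of_ne (fun h0 => hne (inv_mul_eq_one.1 h0).symm)] at h2
  exact one_ne_zero h2

/-- The unitaries `λ_g` are closed under products and adjoints, so their linear span is already
dense and no multiplicative step is needed. -/
theorem reducedCStar_induction {P : ReducedCStar Γ → Prop} (hcl : IsClosed {a | P a})
    (hu : ∀ g, P (regularUnitary Γ g)) (h0 : P 0) (hadd : ∀ a b, P a → P b → P (a + b))
    (hsmul : ∀ (c : ℂ) a, P a → P (c • a)) (a : ReducedCStar Γ) : P a := by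
  let A₀ := StarAlgebra.adjoin ℂ (Set.range (leftRegular (Γ := Γ)))
  have hspan : ∀ T ∈ Submodule.span ℂ (Set.range (leftRegular (Γ := Γ))),
      ∃ hT : T ∈ ReducedCStar Γ, P ⟨T, hT⟩ := by
    intro T h
    induction h using Submodule.span_induction with
    | mem x hx => obtain ⟨g, rfl⟩ := hx; exact ⟨leftRegular_mem g, hu g⟩
    | zero => exact ⟨zero_mem _, h0⟩
    | add x y _ _ hx hy =>
      obtain ⟨hx1, hx⟩ := hx
      obtain ⟨hy1, hy⟩ := hy
      exact ⟨add_mem hx1 hy1, hadd _ _ hx hy⟩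
    | smul c x _ hx =>
      obtain ⟨hx1, hx⟩ := hx
      exact ⟨(ReducedCStar Γ).smul_mem hx1 c, hsmul c _ hx⟩
  have hmem : (a : EllTwo Γ →L[ℂ] EllTwo Γ) ∈ closure (A₀ : Set (EllTwo Γ →L[ℂ] EllTwo Γ)) := a.2
  let B : Set (ReducedCStar Γ) := {b | (b : EllTwo Γ →L[ℂ] EllTwo Γ) ∈ A₀}
  have hB : B ⊆ {b | P b} := fun b hb => (hspan b (adjoin_leftRegular_subset_span hb)).2
  refine (hcl.closure_subset_iff.2 hB) (closure_subtype.2 ?_)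
  convert hmem
  ext T
  constructor
  · rintro ⟨b, hb, rfl⟩; exact hb
  · intro hT; exact ⟨⟨T, StarSubalgebra.le_topologicalClosure _ hT⟩, hT, rfl⟩

theorem exists_functional_of_amenable_subgroup (L : Subgroup Γ) (hL : IsAmenableGroup L)
    (χ : L →* ℂ) (hχ : ∀ g, ‖χ g‖ = 1) :
    ∃ φ : ReducedCStar Γ →ₗ[ℂ] ℂ, (∀ a, 0 ≤ φ (star a * a)) ∧
      ∀ l : L, φ (regularUnitary Γ l) = χ l := by
  obtain ⟨Φ, hpos, hΦ⟩ := hL.exists_state χ hχ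
  refine ⟨Φ ∘ₗ compression L ∘ₗ (ReducedCStar Γ).toSubalgebra.toSubmodule.subtype,
    fun a => hpos _ ?_, fun l => ?_⟩
  · have h := (ContinuousLinearMap.isPositive_adjoint_comp_self
      (a : EllTwo Γ →L[ℂ] EllTwo Γ)).conj_adjoint (pullback (Function.Embedding.subtype (· ∈ L)))
    exact h
  · change Φ (compression L (leftRegular (l : Γ))) = _
    rw [compression_leftRegular_of_mem, hΦ]

/-! ### The GNS representation -/

theorem exists_cyclic_representation {A : Type v} [CStarAlgebra A] (φ : A →ₗ[ℂ] ℂ)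
    (hφ : ∀ a, 0 ≤ φ (star a * a)) :
    ∃ (E : Type v) (_ : NormedAddCommGroup E) (_ : InnerProductSpace ℂ E) (_ : CompleteSpace E)
      (π : A →⋆ₐ[ℂ] (E →L[ℂ] E)) (v : E),
      Continuous π ∧ DenseRange (fun a => π a v) ∧ ∀ a, ⟪v, π a v⟫_ℂ = φ a := by
  let _ := CStarAlgebra.spectralOrder A
  have _ := CStarAlgebra.spectralOrderedRing A
  let f : A →ₚ[ℂ] ℂ := PositiveLinearMap.mk₀ φ fun a ha => by
    obtain ⟨b, rfl⟩ := CStarAlgebra.nonneg_iff_eq_star_mul_self.1 ha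
    exact hφ b
  have hπ : ∀ a, f.gnsStarAlgHom a (f.toPreGNS 1 : f.GNS) = (f.toPreGNS a : f.GNS) := by
    intro a
    change f.gnsNonUnitalStarAlgHom a (f.toPreGNS 1 : f.GNS) = _
    simp
  refine ⟨f.GNS, inferInstance, inferInstance, inferInstance, f.gnsStarAlgHom,
    (f.toPreGNS 1 : f.GNS), map_continuous _, ?_, fun a => ?_⟩
  · simp only [hπ]
    exact UniformSpace.Completion.denseRange_coe.comp f.toPreGNS.surjective.denseRange
      (UniformSpace.Completion.continuous_coe _)
  · rw [hπ, UniformSpace.Completion.inner_coe, PositiveLinearMap.preGNS_inner_def]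
    simp
    rfl

/-- The unit vectors `v` and `π(λ_l) v` have inner product `χ(l)` of modulus one; equality in
Cauchy–Schwarz makes `v` an eigenvector. -/
theorem exists_cyclic_representation_of_amenable_subgroup (L : Subgroup Γ)
    (hL : IsAmenableGroup L) (χ : L →* ℂ) (hχ : ∀ g, ‖χ g‖ = 1) :
    ∃ (E : Type v) (_ : NormedAddCommGroup E) (_ : InnerProductSpace ℂ E) (_ : CompleteSpace E)
      (π : ReducedCStar Γ →⋆ₐ[ℂ] (E →L[ℂ] E)) (v : E),
      Continuous π ∧ ‖v‖ = 1 ∧ DenseRange (fun a => π a v) ∧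
      ∀ l : L, π (regularUnitary Γ l) v = χ l • v := by
  obtain ⟨φ, hφ, hφL⟩ := exists_functional_of_amenable_subgroup L hL χ hχ
  have : IsClosed (ReducedCStar Γ : Set (EllTwo Γ →L[ℂ] EllTwo Γ)) := isClosed_reducedCStar
  let _ : CStarAlgebra (ReducedCStar Γ) := StarSubalgebra.cstarAlgebra _
  obtain ⟨E, i1, i2, i3, π, v, hπc, hv, hπ⟩ := exists_cyclic_representation φ hφ
  have hone : φ 1 = 1 := by simpa using hφL 1
  have hv1 : ‖v‖ = 1 := by
    have h := hπ 1
    rw [map_one, hone] at h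
    have h : ‖v‖ ^ 2 = 1 := by
      rw [norm_sq_eq_re_inner (𝕜 := ℂ)]
      exact congrArg Complex.re h
    exact (pow_eq_one_iff_of_nonneg (norm_nonneg _) two_ne_zero).1 h
  refine ⟨E, i1, i2, i3, π, v, hπc, hv1, hv, fun l => ?_⟩
  · have hinner : ⟪v, π (regularUnitary Γ l) v⟫_ℂ = χ l := by rw [hπ, hφL]
    have hnorm : ‖π (regularUnitary Γ l) v‖ ^ 2 = 1 := by
      have h : ⟪π (regularUnitary Γ l) v, π (regularUnitary Γ l) v⟫_ℂ = 1 := by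
        rw [← ContinuousLinearMap.adjoint_inner_right, ← ContinuousLinearMap.star_eq_adjoint,
          ← map_star, star_regularUnitary, ← mul_apply_eq_comp, ← map_mul, ← map_mul,
          inv_mul_cancel, map_one, hπ, hone]
      rw [norm_sq_eq_re_inner (𝕜 := ℂ)]
      exact congrArg Complex.re h
    rw [← sub_eq_zero, ← norm_eq_zero, ← sq_eq_zero_iff]
    have hexp := norm_sub_sq (𝕜 := ℂ) (π (regularUnitary Γ l) v) (χ l • v)
    rw [hexp, hnorm, norm_smul, hχ, hv1, inner_smul_right, ← inner_conj_symm, hinner,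
      Complex.mul_conj, Complex.normSq_eq_norm_sq, hχ]
    norm_num

/-! ### Conditional expectations of group unitaries -/

theorem continuous_condExpSubgroup (N : Subgroup Γ) : Continuous (condExpSubgroup N) :=
  ((continuous_compression N).comp continuous_subtype_val).subtype_mk _

theorem condExpSubgroup_regularUnitary_of_mem (N : Subgroup Γ) (n : N) :
    condExpSubgroup N (regularUnitary Γ n) = regularUnitary N n :=
  Subtype.ext (compression_leftRegular_of_mem N n)

theorem condExpSubgroup_regularUnitary_mul (N : Subgroup Γ) (m n : N) :
    condExpSubgroup N (regularUnitary Γ ((m : Γ) * (n : Γ))) =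
      regularUnitary N m * regularUnitary N n := by
  rw [← Subgroup.coe_mul, condExpSubgroup_regularUnitary_of_mem, MonoidHom.map_mul]

theorem condExpSubgroup_regularUnitary_of_notMem (N : Subgroup Γ) {g : Γ} (hg : g ∉ N) :
    condExpSubgroup N (regularUnitary Γ g) = 0 :=
  Subtype.ext (compression_leftRegular_of_notMem N g hg)

theorem TwoSidedIdeal.complex_smul_mem {A : Type v} [Ring A] [Algebra ℂ A] (I : TwoSidedIdeal A)
    (c : ℂ) {a : A} (ha : a ∈ I) : c • a ∈ I := by
  rw [← one_mul a, ← smul_mul_assoc]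
  exact I.mul_mem_left _ _ ha

theorem mem_inducedIdeal_of_regularUnitary (N : Subgroup Γ) {I : TwoSidedIdeal (ReducedCStar N)}
    (hI : IsClosed (I : Set (ReducedCStar N))) (b : ReducedCStar Γ)
    (h : ∀ k l, condExpSubgroup N (regularUnitary Γ k * b * regularUnitary Γ l) ∈ I) :
    b ∈ inducedIdeal N I := by
  rw [mem_inducedIdeal]
  have hc := continuous_condExpSubgroup N
  intro x y
  induction y using reducedCStar_induction with
  | hcl => exact hI.preimage (hc.comp (continuous_const.mul continuous_id))
  | h0 => rw [mul_zero, map_zero]; exact I.zero_mem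
  | hadd a a' ha ha' => rw [mul_add, map_add]; exact I.add_mem ha ha'
  | hsmul c a ha => rw [mul_smul_comm, map_smul]; exact I.complex_smul_mem c ha
  | hu l =>
    induction x using reducedCStar_induction with
    | hcl =>
      exact hI.preimage (hc.comp ((continuous_id.mul continuous_const).mul continuous_const))
    | h0 => rw [zero_mul, zero_mul, map_zero]; exact I.zero_mem
    | hadd a a' ha ha' => rw [add_mul, add_mul, map_add]; exact I.add_mem ha ha'
    | hsmul c a ha => rw [smul_mul_assoc, smul_mul_assoc, map_smul]; exact I.complex_smul_mem c ha
    | hu k => exact h k l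

/-- `λ_k (1 - λ_d) λ_l = (1 - λ_{kdk⁻¹}) λ_{kl}`. Its expectation is a multiple of an element of `I`
when `kl ∈ N`, and `0` otherwise. -/
theorem one_sub_mem_inducedIdeal {N : Subgroup Γ} {I : TwoSidedIdeal (ReducedCStar N)}
    (hI : IsClosed (I : Set (ReducedCStar N))) {d : Γ} (hd : ∀ k, k * d * k⁻¹ ∈ N)
    (h : ∀ k, 1 - regularUnitary N ⟨k * d * k⁻¹, hd k⟩ ∈ I) :
    1 - regularUnitary Γ d ∈ inducedIdeal N I := by
  refine mem_inducedIdeal_of_regularUnitary N hI _ fun k l => ?_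
  have h2 : regularUnitary Γ k * (1 - regularUnitary Γ d) * regularUnitary Γ l =
      regularUnitary Γ (k * l) - regularUnitary Γ (k * d * k⁻¹ * (k * l)) := by
    have e : k * d * k⁻¹ * (k * l) = k * d * l := by group
    rw [e, mul_sub, mul_one, sub_mul, MonoidHom.map_mul, MonoidHom.map_mul, MonoidHom.map_mul]
  rw [h2, LinearMap.map_sub]
  by_cases hkl : k * l ∈ N
  · have e1 := condExpSubgroup_regularUnitary_of_mem N ⟨k * l, hkl⟩
    have e2 := condExpSubgroup_regularUnitary_mul N ⟨k * d * k⁻¹, hd k⟩ ⟨k * l, hkl⟩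
    have h3 := I.mul_mem_right _ (regularUnitary N ⟨k * l, hkl⟩) (h k)
    rw [sub_mul, one_mul, ← e2, ← e1] at h3
    exact h3
  · rw [condExpSubgroup_regularUnitary_of_notMem N hkl,
      condExpSubgroup_regularUnitary_of_notMem N fun h' =>
        hkl ((N.mul_mem_cancel_left (hd k)).1 h'), sub_zero]
    exact I.zero_mem

/-- An ideal induced from a normal subgroup `N` that contains `p (λ_h - 1)`, where `h ∉ N` and
`p = 1 - λ_d` with `d ∈ N`, contains `p`. -/
theorem one_sub_mem_of_isInducedFrom {N : Subgroup Γ} [N.Normal]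
    {J : TwoSidedIdeal (ReducedCStar Γ)} (hJ : IsInducedFrom N J) {d h : Γ} (hd : d ∈ N) (hh : h ∉ N)
    (hmem : (1 - regularUnitary Γ d) * (regularUnitary Γ h - 1) ∈ J) :
    1 - regularUnitary Γ d ∈ J := by
  obtain ⟨I, hI, rfl⟩ := hJ
  have hnorm : N.Normal := inferInstance
  have hd' : ∀ k, k * d * k⁻¹ ∈ N := fun k => hnorm.conj_mem d hd k
  refine one_sub_mem_inducedIdeal hI hd' fun k => ?_
  -- The right factor cancels `kh`: the `λ_h` part of the product becomes `1 - λ_{kdk⁻¹}`, supported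
  -- in `N`, while the other part is supported outside `N` and is killed by the expectation.
  have h1 := (mem_inducedIdeal N I _).1 hmem (regularUnitary Γ k) (regularUnitary Γ (h⁻¹ * k⁻¹))
  have hk : k * (h⁻¹ * k⁻¹) ∉ N := fun hk => hh (by
    have := N.inv_mem (hnorm.conj_mem _ hk k⁻¹)
    simpa [mul_assoc] using this)
  have hk' : k * d * (h⁻¹ * k⁻¹) ∉ N := fun hk' => hk (by
    have := N.mul_mem (N.inv_mem (hd' k)) hk'
    simpa [mul_assoc] using this)
  have h2 : regularUnitary Γ k * ((1 - regularUnitary Γ d) * (regularUnitary Γ h - 1)) *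
      regularUnitary Γ (h⁻¹ * k⁻¹) =
      regularUnitary Γ ((1 : N) : Γ) - regularUnitary Γ (k * d * k⁻¹)
        - regularUnitary Γ (k * (h⁻¹ * k⁻¹)) + regularUnitary Γ (k * d * (h⁻¹ * k⁻¹)) := by
    have e1 : ((1 : N) : Γ) = k * h * (h⁻¹ * k⁻¹) := by simp [mul_assoc]
    have e2 : k * d * k⁻¹ = k * d * h * (h⁻¹ * k⁻¹) := by simp [mul_assoc]
    rw [e1, e2]
    simp only [MonoidHom.map_mul, mul_sub, sub_mul, mul_one, one_mul, mul_assoc]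
    abel
  have e3 := condExpSubgroup_regularUnitary_of_mem N ⟨k * d * k⁻¹, hd' k⟩
  have e4 := condExpSubgroup_regularUnitary_of_mem N 1
  rw [h2, LinearMap.map_add, LinearMap.map_sub, LinearMap.map_sub,
    condExpSubgroup_regularUnitary_of_notMem N hk,
    condExpSubgroup_regularUnitary_of_notMem N hk', e3, e4, MonoidHom.map_one, sub_zero,
    add_zero] at h1
  exact h1

/-! ### Primitive ideals from sign characters -/

/-- Let `w ≠ 0` lie in an invariant `W`. Cyclicity gives `a` with `⟪π a v, w⟫ ≠ 0`. Then `π(p) π(a*)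
w` is a multiple of `v`, nonzero because its pairing with `v` is, so `v ∈ W` and `W` is everything.
-/
theorem isIrreducibleRep_of_rank_one {A E : Type v} [Ring A] [StarRing A] [Algebra ℂ A]
    [NormedAddCommGroup E] [InnerProductSpace ℂ E] [CompleteSpace E]
    (π : A →⋆ₐ[ℂ] (E →L[ℂ] E)) {v : E} (hv0 : v ≠ 0) (hv : DenseRange fun a => π a v) {p : A}
    (hp : IsSelfAdjoint p) (hpv : ∃ c : ℂ, c ≠ 0 ∧ π p v = c • v)
    (hrank : ∀ a, ∃ c : ℂ, π (p * a) v = c • v) : IsIrreducibleRep π := by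
  refine ⟨⟨v, 0, hv0⟩, fun W hW hinv => ?_⟩
  have hrank' : ∀ w, π p w ∈ Submodule.span ℂ {v} := by
    intro w
    have hcl : IsClosed {w | π p w ∈ Submodule.span ℂ {v}} :=
      (Submodule.closed_of_finiteDimensional (Submodule.span ℂ {v})).preimage (π p).continuous
    refine hcl.closure_subset_iff.2 ?_ (hv w)
    rintro _ ⟨a, rfl⟩
    obtain ⟨c, hc⟩ := hrank a
    refine Submodule.mem_span_singleton.2 ⟨c, ?_⟩
    rw [← hc, map_mul]
    rfl
  obtain ⟨c, hc0, hc⟩ := hpv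
  by_cases hW0 : W = ⊥
  · exact Or.inl hW0
  right
  obtain ⟨w, hwW, hw0⟩ := W.ne_bot_iff.1 hW0
  have hadj : ∀ (a : A) (x y : E), ⟪π a x, y⟫_ℂ = ⟪x, π (star a) y⟫_ℂ := fun a x y => by
    rw [map_star, ContinuousLinearMap.star_eq_adjoint, ContinuousLinearMap.adjoint_inner_right]
  have hex : ∃ a, ⟪π a v, w⟫_ℂ ≠ 0 := by
    by_contra! h0
    have hcl : IsClosed {x | ⟪x, w⟫_ℂ = 0} := isClosed_eq (by fun_prop) continuous_const
    have : w ∈ {x | ⟪x, w⟫_ℂ = 0} := hcl.closure_subset_iff.2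
      (by rintro _ ⟨a, rfl⟩; exact h0 a) (hv w)
    exact hw0 (inner_self_eq_zero.1 this)
  obtain ⟨a, ha⟩ := hex
  have hvW : v ∈ W := by
    obtain ⟨z, hz⟩ := Submodule.mem_span_singleton.1 (hrank' (π (star a) w))
    have hz0 : z ≠ 0 := by
      rintro rfl
      rw [zero_smul] at hz
      have h1 : ⟪π p v, π (star a) w⟫_ℂ = 0 := by
        rw [hadj, hp.star_eq, ← hz, inner_zero_right]
      rw [hc, inner_smul_left, ← hadj, mul_eq_zero] at h1
      exact h1.elim (fun h => hc0 (by simpa using h)) ha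
    have h1 : z • v ∈ W := by
      rw [hz]
      exact hinv _ _ (hinv _ _ hwW)
    exact (W.smul_mem_iff hz0).1 h1
  rw [eq_top_iff]
  intro x _
  exact hW.closure_subset_iff.2 (by rintro _ ⟨b, rfl⟩; exact hinv b v hvW) (hv x)

theorem exists_primitiveIdeal_not_induced {N L : Subgroup Γ} [N.Normal] (hL : IsAmenableGroup L)
    (χ : L →* ℂ) (hχ : ∀ l, ‖χ l‖ = 1) {d h : Γ} (hdN : d ∈ N) (hdL : d ∈ L)
    (hd2 : d * d = 1) (hχd : χ ⟨d, hdL⟩ ≠ 1) (hhN : h ∉ N) (hhL : h ∈ L) (hdh : d * h = h * d)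
    (hχh : χ ⟨h, hhL⟩ = 1)
    (hconj : ∀ k ∉ L, ∃ hk : k⁻¹ * d * k ∈ L, χ ⟨k⁻¹ * d * k, hk⟩ = 1) :
    ∃ J : TwoSidedIdeal (ReducedCStar Γ), IsPrimitiveIdeal J ∧ ¬ IsInducedFrom N J := by
  obtain ⟨E, i1, i2, i3, π, v, hπc, hv1, hv, hπ⟩ :=
    exists_cyclic_representation_of_amenable_subgroup L hL χ hχ
  have hv0 : v ≠ 0 := by rintro rfl; simp at hv1
  let u := regularUnitary Γ
  let p : ReducedCStar Γ := 1 - u d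
  have hp : IsSelfAdjoint p := by
    change star p = p
    simp only [p, star_sub, star_one, u, star_regularUnitary, inv_eq_of_mul_eq_one_left hd2]
  have hpv : π p v = (1 - χ ⟨d, hdL⟩) • v := by
    simp only [p, map_sub, map_one, sub_smul, one_smul]
    rw [← hπ]
    rfl
  have hmul : ∀ a b w, π (a * b) w = π a (π b w) := fun a b w => by rw [map_mul]; rfl
  have hpu : ∀ k, ∃ c : ℂ, π (p * u k) v = c • v := by
    intro k
    by_cases hk : k ∈ L
    · refine ⟨χ ⟨k, hk⟩ * (1 - χ ⟨d, hdL⟩), ?_⟩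
      have e : π (u k) v = χ ⟨k, hk⟩ • v := hπ ⟨k, hk⟩
      rw [hmul, e, map_smul, hpv, smul_smul]
    · obtain ⟨hk', hχk⟩ := hconj k hk
      refine ⟨0, ?_⟩
      -- Moving `p` past `u k` conjugates `d` into an element of `L` that fixes `v`.
      have e : p * u k = u k * (1 - u (k⁻¹ * d * k)) := by
        have : d * k = k * (k⁻¹ * d * k) := by group
        simp only [p, sub_mul, mul_sub, one_mul, mul_one, ← map_mul, ← this]
      have e' : π (u (k⁻¹ * d * k)) v = v := by
        have := hπ ⟨_, hk'⟩
        rwa [hχk, one_smul] at this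
      rw [e, hmul, map_sub, map_one, zero_smul]
      change π (u k) (v - π (u (k⁻¹ * d * k)) v) = 0
      rw [e', sub_self, map_zero]
  have hrank' : ∀ a, π (p * a) v ∈ Submodule.span ℂ {v} := by
    intro a
    induction a using reducedCStar_induction with
    | hcl =>
      have hc : Continuous fun a => π (p * a) v :=
        (ContinuousLinearMap.apply ℂ E v).continuous.comp
          (hπc.comp (continuous_const.mul continuous_id))
      exact (Submodule.closed_of_finiteDimensional (Submodule.span ℂ {v})).preimage hc
    | hu g =>
      obtain ⟨c, hc⟩ := hpu g
      exact Submodule.mem_span_singleton.2 ⟨c, hc.symm⟩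
    | h0 => rw [mul_zero, map_zero]; exact Submodule.zero_mem _
    | hadd a b ha hb => rw [mul_add, map_add]; exact Submodule.add_mem _ ha hb
    | hsmul c a ha => rw [mul_smul_comm, map_smul]; exact Submodule.smul_mem _ c ha
  have hrank : ∀ a, ∃ c : ℂ, π (p * a) v = c • v := fun a => by
    obtain ⟨c, hc⟩ := Submodule.mem_span_singleton.1 (hrank' a)
    exact ⟨c, hc.symm⟩
  have hc0 : 1 - χ ⟨d, hdL⟩ ≠ 0 := sub_ne_zero.2 (Ne.symm hχd)
  let J : TwoSidedIdeal (ReducedCStar Γ) := TwoSidedIdeal.ker π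
  have hJ : ∀ a, a ∈ J ↔ π a = 0 := fun a => TwoSidedIdeal.mem_ker π
  refine ⟨J, ⟨E, i1, i2, i3, π, isIrreducibleRep_of_rank_one π hv0 hv hp
    ⟨_, hc0, hpv⟩ hrank, hJ⟩, fun hind => ?_⟩
  have hpJ : p ∈ J := by
    refine one_sub_mem_of_isInducedFrom hind hdN hhN ((hJ _).2 ?_)
    have hcomm : p * (u h - 1) = (u h - 1) * p := by
      simp only [p, sub_mul, mul_sub, one_mul, mul_one, ← map_mul, hdh]
      abel
    -- `π p` maps the dense orbit of `v` into `ℂv`, and `u h - 1` annihilates `v`.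
    have hzero : ∀ a, π ((u h - 1) * p) (π a v) = 0 := by
      intro a
      obtain ⟨c, hc⟩ := hrank a
      have e : π (u h) v = v := by
        have := hπ ⟨_, hhL⟩
        rwa [hχh, one_smul] at this
      rw [hmul, ← hmul p, hc, map_smul, map_sub, map_one]
      change c • (π (u h) v - v) = 0
      rw [e, sub_self, smul_zero]
    change π (p * (u h - 1)) = 0
    rw [hcomm]
    refine DFunLike.coe_injective (hv.equalizer (by fun_prop) (by fun_prop) ?_)
    funext a
    exact hzero a
  have h0 : π p v = 0 := by rw [(hJ p).1 hpJ]; rfl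
  rw [hpv] at h0
  exact (smul_ne_zero hc0 hv0) h0

/-! ### Consequences of C*-simplicity -/

/-- The trivial character of `N` yields a representation with an `N`-fixed cyclic vector. By
normality `N` then acts trivially on the whole space, so every `λ_n - 1` lies in a proper closed
ideal, which must be `0`. -/
theorem IsCStarSimple.eq_bot_of_isAmenableGroup (hΓ : IsCStarSimple Γ) (N : Subgroup Γ) [N.Normal]
    (hN : IsAmenableGroup N) : N = ⊥ := by
  obtain ⟨E, i1, i2, i3, π, v, hπc, hv1, hv, hπ⟩ :=
    exists_cyclic_representation_of_amenable_subgroup N hN 1 (fun _ => by simp)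
  have hmem : ∀ a, a ∈ TwoSidedIdeal.ker π ↔ π a = 0 := fun a => TwoSidedIdeal.mem_ker π
  have hcl : IsClosed (TwoSidedIdeal.ker π : Set (ReducedCStar Γ)) := by
    have h : (TwoSidedIdeal.ker π : Set (ReducedCStar Γ)) = π ⁻¹' {0} := by
      ext a; exact hmem a
    rw [h]
    exact isClosed_singleton.preimage hπc
  have hmul : ∀ a b w, π (a * b) w = π a (π b w) := fun a b w => by rw [map_mul]; rfl
  rcases hΓ _ hcl with hbot | htop
  · rw [Subgroup.eq_bot_iff_forall]
    intro n hn
    have hker : regularUnitary Γ n - 1 ∈ TwoSidedIdeal.ker π := by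
      rw [hmem]
      have hz : ∀ a, π ((regularUnitary Γ n - 1) * a) v = 0 := by
        intro a
        induction a using reducedCStar_induction with
        | hcl =>
          have hc : Continuous fun a => π ((regularUnitary Γ n - 1) * a) v :=
            (ContinuousLinearMap.apply ℂ E v).continuous.comp
              (hπc.comp (continuous_const.mul continuous_id))
          exact isClosed_eq hc continuous_const
        | hu g =>
          have hn' : g⁻¹ * n * g ∈ N := by
            simpa using (inferInstance : N.Normal).conj_mem n hn g⁻¹
          have e : (regularUnitary Γ n - 1) * regularUnitary Γ g =
              regularUnitary Γ g * (regularUnitary Γ (g⁻¹ * n * g) - 1) := by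
            have : n * g = g * (g⁻¹ * n * g) := by group
            simp only [sub_mul, mul_sub, one_mul, mul_one, ← map_mul, ← this]
          have e' : π (regularUnitary Γ (g⁻¹ * n * g)) v = v := by
            simpa using hπ ⟨_, hn'⟩
          rw [e, hmul, map_sub, map_one]
          change π (regularUnitary Γ g) (π (regularUnitary Γ (g⁻¹ * n * g)) v - v) = 0
          rw [e', sub_self, map_zero]
        | h0 => rw [mul_zero, map_zero]; rfl
        | hadd a b ha hb =>
          rw [mul_add, map_add]
          change π _ v + π _ v = 0
          rw [ha, hb, add_zero]
        | hsmul c a ha =>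
          rw [mul_smul_comm, map_smul]
          change c • π _ v = 0
          rw [ha, smul_zero]
      refine DFunLike.coe_injective (hv.equalizer (by fun_prop) (by fun_prop) ?_)
      funext a
      change π (regularUnitary Γ n - 1) (π a v) = 0
      rw [← hmul, hz]
    rw [hbot, TwoSidedIdeal.mem_bot, sub_eq_zero, ← map_one (regularUnitary Γ)] at hker
    exact regularUnitary_injective hker
  · have h1 : (1 : ReducedCStar Γ) ∈ TwoSidedIdeal.ker π := by rw [htop]; trivial
    rw [hmem, map_one] at h1
    have : v = 0 := by
      have h2 := congrArg (fun T : E →L[ℂ] E => T v) h1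
      exact h2
    simp [this] at hv1

/-! ### Invariance of C*-simplicity under isomorphism -/

theorem pullback_pullback_symm {α β : Type v} (e : α ≃ β) (ξ : EllTwo α) :
    pullback e.toEmbedding (pullback e.symm.toEmbedding ξ) = ξ := by
  ext x
  simp

theorem pullback_conj_leftRegular {Γ' : Type v} [Group Γ'] (e : Γ ≃* Γ') (g : Γ) :
    pullback e.symm.toEquiv.toEmbedding ∘L leftRegular g ∘L pullback e.toEquiv.toEmbedding =
      leftRegular (e g) := by
  ext ξ x
  change ξ (e (g⁻¹ * e.symm x)) = ξ ((e g)⁻¹ * x)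
  rw [map_mul, map_inv, MulEquiv.apply_symm_apply]

theorem pullback_conj_mem {Γ' : Type v} [Group Γ'] (e : Γ ≃* Γ') (a : ReducedCStar Γ) :
    pullback e.symm.toEquiv.toEmbedding ∘L (a : EllTwo Γ →L[ℂ] EllTwo Γ) ∘L
      pullback e.toEquiv.toEmbedding ∈ ReducedCStar Γ' := by
  induction a using reducedCStar_induction with
  | hcl =>
    refine isClosed_reducedCStar.preimage ?_
    have : Continuous fun a : ReducedCStar Γ => (a : EllTwo Γ →L[ℂ] EllTwo Γ) :=
      continuous_subtype_val
    fun_prop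
  | hu g =>
    have h := pullback_conj_leftRegular e g
    change pullback e.symm.toEquiv.toEmbedding ∘L leftRegular g ∘L
      pullback e.toEquiv.toEmbedding ∈ _
    rw [h]
    exact leftRegular_mem _
  | h0 =>
    convert zero_mem (ReducedCStar Γ') using 1
    ext ξ x
    simp
  | hadd a b ha hb =>
    convert add_mem ha hb using 1
    ext ξ x
    simp
  | hsmul c a ha =>
    convert (ReducedCStar Γ').smul_mem ha c using 1
    ext ξ x
    simp

/-- The homomorphism of reduced group C*-algebras induced by a group isomorphism. -/
def reducedCStarMap {Γ' : Type v} [Group Γ'] (e : Γ ≃* Γ') :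
    ReducedCStar Γ →+* ReducedCStar Γ' where
  toFun a := ⟨_, pullback_conj_mem e a⟩
  map_one' := by
    refine Subtype.ext ?_
    ext ξ x
    change ξ (e (e.symm x)) = ξ x
    rw [MulEquiv.apply_symm_apply]
  map_mul' a b := by
    refine Subtype.ext ?_
    ext ξ x
    change (a : EllTwo Γ →L[ℂ] EllTwo Γ) ((b : EllTwo Γ →L[ℂ] EllTwo Γ)
      (pullback e.toEquiv.toEmbedding ξ)) (e.symm x) =
      (a : EllTwo Γ →L[ℂ] EllTwo Γ) (pullback e.toEquiv.toEmbedding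
        (pullback e.symm.toEquiv.toEmbedding ((b : EllTwo Γ →L[ℂ] EllTwo Γ)
          (pullback e.toEquiv.toEmbedding ξ)))) (e.symm x)
    exact congrArg (fun η => (a : EllTwo Γ →L[ℂ] EllTwo Γ) η (e.symm x))
      (pullback_pullback_symm e.toEquiv _).symm
  map_zero' := by
    refine Subtype.ext ?_
    ext ξ x
    simp
  map_add' a b := by
    refine Subtype.ext ?_
    ext ξ x
    simp

theorem continuous_reducedCStarMap {Γ' : Type v} [Group Γ'] (e : Γ ≃* Γ') :
    Continuous (reducedCStarMap e) := by
  refine Continuous.subtype_mk (f := fun a : ReducedCStar Γ =>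
    pullback e.symm.toEquiv.toEmbedding ∘L (a : EllTwo Γ →L[ℂ] EllTwo Γ) ∘L
      pullback e.toEquiv.toEmbedding) ?_ _
  have : Continuous fun a : ReducedCStar Γ => (a : EllTwo Γ →L[ℂ] EllTwo Γ) :=
    continuous_subtype_val
  fun_prop

theorem reducedCStarMap_symm_apply {Γ' : Type v} [Group Γ'] (e : Γ ≃* Γ') (a : ReducedCStar Γ') :
    reducedCStarMap e (reducedCStarMap e.symm a) = a := by
  refine Subtype.ext ?_
  ext ξ x
  change (a : EllTwo Γ' →L[ℂ] EllTwo Γ') (pullback e.symm.toEquiv.toEmbedding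
    (pullback e.toEquiv.toEmbedding ξ)) (e (e.symm x)) = (a : EllTwo Γ' →L[ℂ] EllTwo Γ') ξ x
  rw [MulEquiv.apply_symm_apply]
  exact congrArg (fun η => (a : EllTwo Γ' →L[ℂ] EllTwo Γ') η x)
    (pullback_pullback_symm e.toEquiv.symm ξ)

theorem IsCStarSimple.of_mulEquiv {Γ' : Type v} [Group Γ'] (h : IsCStarSimple Γ) (e : Γ ≃* Γ') :
    IsCStarSimple Γ' := by
  intro I hI
  have hcl : IsClosed (I.comap (reducedCStarMap e) : Set (ReducedCStar Γ)) :=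
    hI.preimage (continuous_reducedCStarMap e)
  rcases h _ hcl with hbot | htop
  · left
    rw [eq_bot_iff]
    intro x hx
    have h1 : reducedCStarMap e.symm x ∈ I.comap (reducedCStarMap e) := by
      rw [TwoSidedIdeal.mem_comap, reducedCStarMap_symm_apply]
      exact hx
    rw [hbot, TwoSidedIdeal.mem_bot] at h1
    rw [TwoSidedIdeal.mem_bot, ← reducedCStarMap_symm_apply e x, h1, map_zero]
  · right
    have h1 : (1 : ReducedCStar Γ) ∈ I.comap (reducedCStarMap e) := by rw [htop]; trivial
    rw [TwoSidedIdeal.mem_comap, map_one] at h1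
    exact (TwoSidedIdeal.one_mem_iff I).1 h1

/-! ### The wreath product -/

/-- The nontrivial character of `ℤ₂`. -/
def zmodTwoSign (z : ZMod 2) : ℂ := if z = 0 then 1 else -1

theorem zmodTwoSign_add (a b : ZMod 2) : zmodTwoSign (a + b) = zmodTwoSign a * zmodTwoSign b := by
  have h : ∀ z : ZMod 2, z = 0 ∨ z = 1 := by decide
  rcases h a with rfl | rfl <;> rcases h b with rfl | rfl <;>
    simp [zmodTwoSign, CharTwo.add_self_eq_zero]

variable {G : Type v} [Group G] (H : Subgroup G)

/-- The subgroup `(⊕_{G/H} ℤ₂) ⋊ H` of the wreath product. -/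
abbrev wreathStabilizer : Subgroup (WreathZTwo H) :=
  H.comap (SemidirectProduct.rightHom : WreathZTwo H →* G)

theorem inv_smul_one_of_mem {g : G} (hg : g ∈ H) : g⁻¹ • ((1 : G) : G ⧸ H) = ((1 : G) : G ⧸ H) := by
  rw [MulAction.Quotient.smul_coe, QuotientGroup.eq]
  simpa using hg

/-- The character `(f, h) ↦ (-1)^{f(H)}` of `(⊕_{G/H} ℤ₂) ⋊ H`. -/
def wreathSign : wreathStabilizer H →* ℂ where
  toFun l := zmodTwoSign (l.1.left.toAdd ((1 : G) : G ⧸ H))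
  map_one' := by simp [zmodTwoSign]
  map_mul' l m := by
    -- Multiplicativity holds because the `G`-component of `l` lies in `H` and so fixes the base
    -- coset.
    rw [← zmodTwoSign_add, Subgroup.coe_mul, SemidirectProduct.mul_left, toAdd_mul,
      Finsupp.add_apply, shiftAction_apply, inv_smul_one_of_mem H (g := l.1.right) l.2]

theorem norm_wreathSign (l : wreathStabilizer H) : ‖wreathSign H l‖ = 1 := by
  change ‖zmodTwoSign _‖ = 1
  unfold zmodTwoSign
  split_ifs <;> simp

theorem isAmenableGroup_wreathStabilizer (hH : IsAmenableGroup H) :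
    IsAmenableGroup (wreathStabilizer H) := by
  refine (isAmenableGroup_finsupp_zmod_two (G ⧸ H)).of_extension hH
    ((SemidirectProduct.inl : _ →* WreathZTwo H).codRestrict (wreathStabilizer H) fun f => ?_)
    ((SemidirectProduct.rightHom.comp (wreathStabilizer H).subtype).codRestrict H fun l => l.2)
    (fun h => ⟨⟨SemidirectProduct.inr (h : G), ?_⟩, ?_⟩) fun l hl => ⟨l.1.left, ?_⟩
  · simp
  · simp
  · exact Subtype.ext rfl
  · have h1 : l.1.right = 1 := congrArg Subtype.val hl
    exact Subtype.ext (SemidirectProduct.ext rfl h1.symm)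

theorem isAmenableGroup_wreathBase : IsAmenableGroup (wreathBase H) :=
  (isAmenableGroup_finsupp_zmod_two (G ⧸ H)).of_surjective _
    (MonoidHom.rangeRestrict_surjective _)

theorem exists_primitiveIdeal_wreath (hH : IsAmenableGroup H) (hne : H ≠ ⊥) :
    ∃ J : TwoSidedIdeal (ReducedCStar (WreathZTwo H)),
      IsPrimitiveIdeal J ∧ ¬ IsInducedFrom (wreathBase H) J := by
  classical
  obtain ⟨h, hh, h1⟩ := H.bot_or_exists_ne_one.resolve_left hne
  let f : Multiplicative (G ⧸ H →₀ ZMod 2) :=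
    Multiplicative.ofAdd (Finsupp.single ((1 : G) : G ⧸ H) 1)
  have hf : ∀ x, f.toAdd x = if ((1 : G) : G ⧸ H) = x then 1 else 0 := fun x =>
    Finsupp.single_apply
  refine exists_primitiveIdeal_not_induced (isAmenableGroup_wreathStabilizer H hH) (wreathSign H)
    (norm_wreathSign H) (d := SemidirectProduct.inl f) (h := SemidirectProduct.inr h)
    ⟨f, rfl⟩ ?_ ?_ ?_ ?_ ?_ ?_ ?_ ?_
  · simp
  · rw [← map_mul, ← map_one SemidirectProduct.inl]
    congr 1
    ext x
    exact CharTwo.add_self_eq_zero (f.toAdd x)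
  · change zmodTwoSign (f.toAdd ((1 : G) : G ⧸ H)) ≠ 1
    rw [hf, if_pos rfl]
    norm_num [zmodTwoSign]
  · rintro ⟨f', hf'⟩
    exact h1 (by simpa using (congrArg SemidirectProduct.right hf').symm)
  · simpa using hh
  · refine SemidirectProduct.ext ?_ (by simp)
    ext x
    simp only [SemidirectProduct.mul_left, SemidirectProduct.left_inl, SemidirectProduct.right_inl,
      SemidirectProduct.left_inr, SemidirectProduct.right_inr, map_one, mul_one, one_mul]
    change f.toAdd x = f.toAdd (h⁻¹ • x)
    rw [hf, hf]
    refine if_congr ?_ rfl rfl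
    have h2 := inv_smul_one_of_mem H (H.inv_mem hh)
    rw [inv_inv] at h2
    rw [eq_inv_smul_iff, h2]
  · change zmodTwoSign 0 = 1
    simp [zmodTwoSign]
  · intro k hk
    refine ⟨by simp, ?_⟩
    change zmodTwoSign ((k⁻¹ * SemidirectProduct.inl f * k).left.toAdd _) = 1
    -- Conjugation by `k` moves the point mass to the coset `k⁻¹H ≠ H`. The two contributions of
    -- `k.left` to the value at `H` cancel.
    have hx : f.toAdd (k.right • ((1 : G) : G ⧸ H)) = 0 := by
      rw [hf, if_neg]
      intro h0
      apply hk
      rw [MulAction.Quotient.smul_coe, QuotientGroup.eq] at h0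
      simpa using h0
    simp only [SemidirectProduct.mul_left, toAdd_mul, Finsupp.add_apply, shiftAction_apply,
      SemidirectProduct.inv_left, SemidirectProduct.inv_right, SemidirectProduct.mul_right,
      SemidirectProduct.left_inl, SemidirectProduct.right_inl, mul_one, inv_inv, hx, toAdd_inv,
      Finsupp.neg_apply]
    simp [zmodTwoSign, CharTwo.add_self_eq_zero]

/-- An amenable normal subgroup has amenable normal image in `G`, hence trivial image, so it lies in
the kernel of the projection, which is the base. -/
theorem isAmenableRadical_wreathBase (hG : IsCStarSimple G) :
    IsAmenableRadical (wreathBase H) := by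
  refine ⟨⟨inferInstance, isAmenableGroup_wreathBase H⟩, ?_⟩
  rintro N ⟨hN, hNa⟩
  have hnorm : (N.map (SemidirectProduct.rightHom : WreathZTwo H →* G)).Normal :=
    hN.map _ SemidirectProduct.rightHom_surjective
  have hbot := hG.eq_bot_of_isAmenableGroup (N.map (SemidirectProduct.rightHom : WreathZTwo H →* G))
    (hNa.of_surjective _ (MonoidHom.subgroupMap_surjective _ N))
  rw [wreathBase, SemidirectProduct.range_inl_eq_ker_rightHom]
  exact (Subgroup.map_eq_bot_iff _).1 hbot

theorem isCStarSimple_quotient_wreathBase (hG : IsCStarSimple G) :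
    IsCStarSimple (WreathZTwo H ⧸ wreathBase H) :=
  hG.of_mulEquiv ((QuotientGroup.quotientMulEquivOfEq
    SemidirectProduct.range_inl_eq_ker_rightHom).trans
      (QuotientGroup.quotientKerEquivOfSurjective (SemidirectProduct.rightHom : WreathZTwo H →* G)
        SemidirectProduct.rightHom_surjective)).symm

end

theorem proposition3p8 {G : Type*} [Group G] (H : Subgroup G)
    (hH : IsAmenableGroup H) (hne : H ≠ ⊥) :
    (Infinite (G ⧸ H) →
      ∃ J : TwoSidedIdeal (ReducedCStar (WreathZTwo H)),
        IsPrimitiveIdeal J ∧ ¬ IsInducedFrom (wreathBase H) J) ∧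
    (IsCStarSimple G →
      IsAmenableRadical (wreathBase H) ∧
      IsCStarSimple (WreathZTwo H ⧸ wreathBase H) ∧
      ∃ J : TwoSidedIdeal (ReducedCStar (WreathZTwo H)),
        IsPrimitiveIdeal J ∧ ¬ IsInducedFrom (wreathBase H) J) :=
  ⟨fun _ => exists_primitiveIdeal_wreath H hH hne, fun hG =>
    ⟨isAmenableRadical_wreathBase H hG, isCStarSimple_quotient_wreathBase H hG,
      exists_primitiveIdeal_wreath H hH hne⟩⟩
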